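/- Let $\mathbb{F}$ be a field, let $\ell \geq 0$ be an integer, and let $Q$ be the equioriented quiver $x_0 \to x_1 \to \cdots \to x_\ell$ of type $\mathbb{A}_\ell$. Its finite-dimensional representations over $\mathbb{F}$ are called ordinary persistence modules. A central charge is a function $\alpha : \{x_0,\ldots,x_\ell\} \to \mathbb{R}$, and the $\alpha$-slope of a nonzero representation $V$ is $$\mu_\alpha(V) = \frac{\sum_i \alpha(x_i)\dim V_{x_i}}{\sum_i \dim V_{x_i}}.$$ A nonzero $V$ is $\alpha$-semistable if $\mu_\alpha(U) \leq \mu_\alpha(V)$ for every nonzero subrepresentation $U \subset V$. The Harder–Narasimhan filtration of $V$ along $\alpha$ is the unique filtration $0 = V^0 \subsetneq V^1 \subsetneq \cdots \subsetneq V^n = V$ by subrepresentations whose successive quotients $S^i = V^i/V^{i-1}$ are $\alpha$-semistable with $\mu_\alpha(S^1) > \cdots > \mu_\alpha(S^n)$, and the Harder–Narasimhan type of $V$ along $\alpha$ is the tuple of dimension vectors $(\underline{\dim}_{S^1}, \ldots, \underline{\dim}_{S^n})$ (the empty tuple if $V = 0$). The central charge $\alpha$ is complete if any two finite-dimensional representations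 of $Q$ over $\mathbb{F}$ with the same Harder–Narasimhan type along $\alpha$ are isomorphic. Then $\alpha$ is complete if and only if $\alpha(x_i) > \alpha(x_{i+1})$ for all $i \in \{0,1,\ldots,\ell-1\}$. -/

import Mathlib

universe u v w

/-- A finite-dimensional representation over the field `K` of a quiver with vertex type `Q`: a
finite-dimensional vector space at each vertex and a linear map along each edge. The spaces live in
the universe of `K`, so that every dimension vector occurs. -/
structure QuiverRep (K : Type u) [Field K] (Q : Type v) [Quiver.{w} Q] where
  obj : Q → Type u
  [addCommGroup : ∀ x, AddCommGroup (obj x)]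
  [module : ∀ x, Module K (obj x)]
  [finiteDimensional : ∀ x, FiniteDimensional K (obj x)]
  map : ∀ {x y : Q}, (x ⟶ y) → obj x →ₗ[K] obj y

attribute [instance] QuiverRep.addCommGroup QuiverRep.module QuiverRep.finiteDimensional

namespace QuiverRep

variable {K : Type u} [Field K] {Q : Type v} [Quiver.{w} Q]

/-- An isomorphism of representations: linear isomorphisms at the vertices that commute with the
maps along the edges. -/
structure Iso (V W : QuiverRep K Q) where
  app : ∀ x, V.obj x ≃ₗ[K] W.obj x
  comm : ∀ {x y : Q} (e : x ⟶ y) (a : V.obj x), app y (V.map e a) = W.map e (app x a)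

/-- The dimension vector `x ↦ dim V_x`. -/
noncomputable def dimVec (V : QuiverRep K Q) : Q → ℕ :=
  fun x => Module.finrank K (V.obj x)

/-- `V` is nonzero: some vertex space is nontrivial. -/
def IsNonzero (V : QuiverRep K Q) : Prop :=
  ∃ x, Nontrivial (V.obj x)

/-- A subrepresentation of `V`: a family of subspaces preserved by the maps along the edges. -/
@[ext]
structure SubRep (V : QuiverRep K Q) where
  sub : ∀ x, Submodule K (V.obj x)
  le_comap : ∀ {x y : Q} (e : x ⟶ y), sub x ≤ (sub y).comap (V.map e)

namespace SubRep

variable {V : QuiverRep K Q}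

/-- Subrepresentations are ordered by vertexwise inclusion. -/
instance : PartialOrder (SubRep V) :=
  PartialOrder.lift SubRep.sub fun _ _ h => SubRep.ext h

/-- The zero subrepresentation. -/
instance : Bot (SubRep V) :=
  ⟨{ sub := fun _ => ⊥, le_comap := fun _ => bot_le }⟩

/-- The whole of `V`. -/
instance : Top (SubRep V) :=
  ⟨{ sub := fun _ => ⊤, le_comap := fun _ _ _ => Submodule.mem_top }⟩

/-- A subrepresentation regarded as a representation. -/
def toRep (U : SubRep V) : QuiverRep K Q where
  obj x := U.sub x
  map e := (V.map e).restrict (U.le_comap e)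

/-- The quotient representation `V / U`. -/
def quotient (U : SubRep V) : QuiverRep K Q where
  obj x := V.obj x ⧸ U.sub x
  map e := (U.sub _).mapQ (U.sub _) (V.map e) (U.le_comap e)

/-- `T ∩ U` as a subrepresentation of `U`; for `T ≤ U` this is `T` inside `U`. -/
def within (T U : SubRep V) : SubRep U.toRep where
  sub x := (T.sub x).submoduleOf (U.sub x)
  le_comap e := fun _ ha => T.le_comap e ha

/-- The subquotient `U / T` for `T ≤ U ⊆ V`. -/
def subquotient (T U : SubRep V) : QuiverRep K Q :=
  (T.within U).quotient

end SubRep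

variable [Fintype Q]

/-- The slope of `V` along the central charge `α` (meaningful for nonzero `V`). -/
noncomputable def slope (α : Q → ℝ) (V : QuiverRep K Q) : ℝ :=
  (∑ x, α x * (V.dimVec x : ℝ)) / ∑ x, (V.dimVec x : ℝ)

/-- `V` is `α`-semistable: it is nonzero, and no nonzero subrepresentation has larger slope. -/
def IsSemistable (α : Q → ℝ) (V : QuiverRep K Q) : Prop :=
  V.IsNonzero ∧ ∀ U : SubRep V, U.toRep.IsNonzero → slope α U.toRep ≤ slope α V

/-- A Harder-Narasimhan filtration `0 = V⁰ ⊊ V¹ ⊊ ⋯ ⊊ Vⁿ = V` along `α`: the successive quotients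
are semistable with strictly decreasing slopes. Length `n = 0` occurs exactly when `V = 0`. -/
structure HNFiltration (α : Q → ℝ) (V : QuiverRep K Q) where
  length : ℕ
  step : Fin (length + 1) → SubRep V
  step_zero : step 0 = ⊥
  step_last : step (Fin.last length) = ⊤
  step_lt : ∀ i : Fin length, step i.castSucc < step i.succ
  semistable : ∀ i : Fin length,
    IsSemistable α ((step i.castSucc).subquotient (step i.succ))
  slope_lt : ∀ i j : Fin length, i < j →
    slope α ((step j.castSucc).subquotient (step j.succ)) <
      slope α ((step i.castSucc).subquotient (step i.succ))

/-- The tuple of dimension vectors of the successive quotients of a filtration. -/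
noncomputable def HNFiltration.type {α : Q → ℝ} {V : QuiverRep K Q} (F : HNFiltration α V) :
    List (Q → ℕ) :=
  List.ofFn fun i : Fin F.length =>
    ((F.step i.castSucc).subquotient (F.step i.succ)).dimVec

open Classical in
/-- The Harder-Narasimhan type of `V` along `α`, read off from the Harder-Narasimhan filtration.
That filtration exists and is unique for every `V` (the empty filtration, with type `[]`, for
`V = 0`), so neither the choice nor the default value matters. -/
noncomputable def hnType (α : Q → ℝ) (V : QuiverRep K Q) : List (Q → ℕ) :=
  if h : Nonempty (HNFiltration α V) then h.some.type else []

variable (K) in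
/-- A collection `A` of central charges on the quiver `Q` is complete, on the category of all
finite-dimensional representations over `K`, if representations whose Harder-Narasimhan types agree
along all members of `A` are isomorphic. -/
def IsComplete (A : Set (Q → ℝ)) : Prop :=
  ∀ V W : QuiverRep K Q, (∀ α ∈ A, hnType α V = hnType α W) → Nonempty (Iso V W)

end QuiverRep

/-- The vertices `x_0, …, x_ℓ` of the equioriented quiver `x_0 → x_1 → ⋯ → x_ℓ` of type `𝔸_ℓ`; its
representations are the ordinary persistence modules. -/
def OrdinaryQuiver (ℓ : ℕ) : Type := Fin (ℓ + 1)

namespace OrdinaryQuiver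

/-- The vertex `x_i`. -/
abbrev x {ℓ : ℕ} (i : Fin (ℓ + 1)) : OrdinaryQuiver ℓ := i

instance (ℓ : ℕ) : Fintype (OrdinaryQuiver ℓ) := inferInstanceAs (Fintype (Fin (ℓ + 1)))

/-- The edges: exactly one edge `x_i → x_{i+1}` for each `0 ≤ i < ℓ`, and no others. -/
inductive Edge (ℓ : ℕ) : OrdinaryQuiver ℓ → OrdinaryQuiver ℓ → Type
  | edge (i : Fin ℓ) : Edge ℓ (x i.castSucc) (x i.succ)

instance (ℓ : ℕ) : Quiver (OrdinaryQuiver ℓ) := ⟨Edge ℓ⟩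

end OrdinaryQuiver

/-!
For a real number `μ`, the function `U ↦ ∑ x, (α x - μ) dim U_x` on subrepresentations of `V` is
modular, so it has a largest maximiser, the truncation of `V` at `μ`; it is the term of the
Harder-Narasimhan filtration made of the subquotients of slope `≥ μ`. The Harder-Narasimhan type is
therefore equivalent to the dimension vectors of all truncations.

If `α x ≤ α y` along an edge `x ⟶ y`, consider representations whose only nonzero maps are along
such edges. Their truncations are the parts supported on the superlevel sets of `α`, so their type
depends on the dimension vector alone; yet one with a line at every vertex may have a nonzero or a
zero map along the edge.

Conversely, if `α` strictly decreases, then interval modules are semistable, and the truncation at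
`μ` is the sum of the bars of slope `≥ μ`. Its dimension at `x_i` counts the bars through `i` of
slope `≥ μ`. As the slope of `[a, b]` strictly decreases in `b`, these counts determine the
multiplicity of each bar.
-/

/-! ### Subrepresentations and slopes -/

namespace QuiverRep

theorem finrank_comap_mkQ {K E : Type*} [DivisionRing K] [AddCommGroup E] [Module K E]
    [FiniteDimensional K E] (N : Submodule K E) (P : Submodule K (E ⧸ N)) :
    Module.finrank K (P.comap N.mkQ) = Module.finrank K P + Module.finrank K N := by
  have h := LinearMap.finrank_range_add_finrank_ker (N.mkQ.domRestrict (P.comap N.mkQ))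
  have hrange : LinearMap.range (N.mkQ.domRestrict (P.comap N.mkQ)) = P := by
    rw [LinearMap.range_domRestrict, Submodule.map_comap_eq_of_surjective N.mkQ_surjective]
  have hker : LinearMap.ker (N.mkQ.domRestrict (P.comap N.mkQ)) =
      N.submoduleOf (P.comap N.mkQ) := by
    rw [LinearMap.ker_domRestrict, Submodule.ker_mkQ]; rfl
  rw [hrange, hker,
    (Submodule.submoduleOfEquivOfLe (Submodule.le_comap_mkQ N P)).finrank_eq] at h
  exact h.symm

variable {K : Type u} [Field K] {Q : Type v} [Quiver.{w} Q] {V W : QuiverRep K Q}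

theorem isNonzero_iff_dimVec_ne_zero : V.IsNonzero ↔ V.dimVec ≠ 0 := by
  simp only [IsNonzero, Function.ne_iff, dimVec, Pi.zero_apply, ← Module.finrank_pos_iff (R := K),
    Nat.pos_iff_ne_zero]

namespace SubRep

instance : Lattice (SubRep V) where
  sup X Y :=
    { sub x := X.sub x ⊔ Y.sub x
      le_comap e := sup_le ((X.le_comap e).trans (Submodule.comap_mono le_sup_left))
        ((Y.le_comap e).trans (Submodule.comap_mono le_sup_right)) }
  le_sup_left _ _ _ := le_sup_left
  le_sup_right _ _ _ := le_sup_right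
  sup_le _ _ _ h h' x := sup_le (h x) (h' x)
  inf X Y :=
    { sub x := X.sub x ⊓ Y.sub x
      le_comap e := fun _ ha => ⟨X.le_comap e ha.1, Y.le_comap e ha.2⟩ }
  inf_le_left _ _ _ := inf_le_left
  inf_le_right _ _ _ := inf_le_right
  le_inf _ _ _ h h' x := le_inf (h x) (h' x)

instance : BoundedOrder (SubRep V) where
  le_top _ _ := le_top
  bot_le _ _ := bot_le

/-- The dimension vector of a subrepresentation. -/
noncomputable abbrev dim (X : SubRep V) : Q → ℕ := X.toRep.dimVec

theorem dim_bot : (⊥ : SubRep V).dim = 0 := funext fun x => finrank_bot K (V.obj x)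

theorem dim_top : (⊤ : SubRep V).dim = V.dimVec := funext fun x => finrank_top K (V.obj x)

theorem dim_mono : Monotone (dim : SubRep V → Q → ℕ) := fun _ _ h x => Submodule.finrank_mono (h x)

theorem dim_strictMono : StrictMono (dim : SubRep V → Q → ℕ) := fun _ _ h =>
  (dim_mono h.le).lt_of_ne fun hd => h.ne <| SubRep.ext <| funext fun x =>
    Submodule.eq_of_le_of_finrank_eq (h.le x) (congrFun hd x)

theorem finite_range_dim [Finite Q] : (Set.range (dim : SubRep V → Q → ℕ)).Finite := by
  classical
  have := Fintype.ofFinite Q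
  exact (Set.finite_Iic (⊤ : SubRep V).dim).subset <|
    Set.range_subset_iff.2 fun _ => dim_mono le_top

theorem dim_sup_add_dim_inf (X Y : SubRep V) : (X ⊔ Y).dim + (X ⊓ Y).dim = X.dim + Y.dim :=
  funext fun _ => Submodule.finrank_sup_add_finrank_inf_eq _ _

variable {T U X : SubRep V}

theorem dimVec_subquotient_add_dim (h : T ≤ U) : (T.subquotient U).dimVec + T.dim = U.dim := by
  funext x
  have := Submodule.finrank_quotient_add_finrank ((T.sub x).submoduleOf (U.sub x))
  rwa [(Submodule.submoduleOfEquivOfLe (h x)).finrank_eq] at this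

theorem dimVec_subquotient_add_dimVec_subquotient (hT : T ≤ X) (hU : X ≤ U) :
    (X.subquotient U).dimVec + (T.subquotient X).dimVec = (T.subquotient U).dimVec := by
  apply add_right_cancel (b := T.dim)
  rw [add_assoc, dimVec_subquotient_add_dim hT, dimVec_subquotient_add_dim hU,
    dimVec_subquotient_add_dim (hT.trans hU)]

theorem dimVec_subquotient_ne_zero (h : T < U) : (T.subquotient U).dimVec ≠ 0 := fun h0 =>
  (dim_strictMono h).ne (by rw [← dimVec_subquotient_add_dim h.le, h0, zero_add])

theorem exists_subRep_subquotient (hT : T ≤ X) (hU : X ≤ U) :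
    ∃ P : SubRep (T.subquotient U), P.dim = (T.subquotient X).dimVec := by
  refine ⟨⟨fun x => ((X.sub x).submoduleOf (U.sub x)).map
    ((T.sub x).submoduleOf (U.sub x)).mkQ, ?_⟩, add_right_cancel (b := T.dim) ?_⟩
  · rintro x y e _ ⟨a, ha, rfl⟩
    exact ⟨⟨V.map e a, U.le_comap e a.2⟩, X.le_comap e ha, rfl⟩
  · rw [dimVec_subquotient_add_dim hT]
    funext x
    have h := finrank_comap_mkQ ((T.sub x).submoduleOf (U.sub x))
      (((X.sub x).submoduleOf (U.sub x)).map ((T.sub x).submoduleOf (U.sub x)).mkQ)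
    have hle : (T.sub x).submoduleOf (U.sub x) ≤ (X.sub x).submoduleOf (U.sub x) :=
      Submodule.comap_mono (hT x)
    rw [Submodule.comap_map_mkQ, sup_eq_right.2 hle,
      (Submodule.submoduleOfEquivOfLe (hT.trans hU x)).finrank_eq,
      (Submodule.submoduleOfEquivOfLe (hU x)).finrank_eq] at h
    exact h.symm

theorem exists_between_of_subRep_subquotient (h : T ≤ U) (P : SubRep (T.subquotient U)) :
    ∃ X : SubRep V, T ≤ X ∧ X ≤ U ∧ (T.subquotient X).dimVec = P.dim := by
  let X : SubRep V :=
    { sub x := ((P.sub x).comap ((T.sub x).submoduleOf (U.sub x)).mkQ).map (U.sub x).subtype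
      le_comap := by
        rintro x y e _ ⟨a, ha, rfl⟩
        exact ⟨⟨V.map e a, U.le_comap e a.2⟩, P.le_comap e ha, rfl⟩ }
  have hTX : T ≤ X := fun x a ha =>
    ⟨⟨a, h x ha⟩, Submodule.le_comap_mkQ ((T.sub x).submoduleOf (U.sub x)) (P.sub x) ha, rfl⟩
  have hXU : X ≤ U := fun x => Submodule.map_subtype_le (U.sub x) _
  refine ⟨X, hTX, hXU, add_right_cancel (b := T.dim) ?_⟩
  rw [dimVec_subquotient_add_dim hTX]
  funext x
  have hdim := finrank_comap_mkQ ((T.sub x).submoduleOf (U.sub x)) (P.sub x)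
  rw [(Submodule.submoduleOfEquivOfLe (h x)).finrank_eq] at hdim
  exact (Submodule.finrank_map_subtype_eq _ _).trans hdim

end SubRep

section Slope

variable {Q : Type*} [Fintype Q] {α : Q → ℝ} {v w : Q → ℕ} {μ ν : ℝ}

/-- The slope of a dimension vector, so that `slope α V` is `dimSlope α V.dimVec`. -/
noncomputable def dimSlope (α : Q → ℝ) (v : Q → ℕ) : ℝ :=
  (∑ x, α x * (v x : ℝ)) / ∑ x, (v x : ℝ)

/-- King's linear form `v ↦ ∑ x, (α x - μ) v x`. On a nonzero dimension vector its sign compares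
the slope with `μ`, and unlike the slope it is additive. -/
def excess (α : Q → ℝ) (μ : ℝ) (v : Q → ℕ) : ℝ :=
  ∑ x, (α x - μ) * (v x : ℝ)

theorem excess_add : excess α μ (v + w) = excess α μ v + excess α μ w := by
  simp only [excess, Pi.add_apply, Nat.cast_add, mul_add, Finset.sum_add_distrib]

theorem excess_antitone (h : μ ≤ ν) : excess α ν v ≤ excess α μ v :=
  Finset.sum_le_sum fun _ _ =>
    mul_le_mul_of_nonneg_right (sub_le_sub_left h _) (Nat.cast_nonneg _)

theorem sum_cast_pos (hv : v ≠ 0) : 0 < ∑ x, (v x : ℝ) := by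
  obtain ⟨x, hx⟩ := Function.ne_iff.1 hv
  exact Finset.sum_pos' (fun _ _ => Nat.cast_nonneg _)
    ⟨x, Finset.mem_univ x, Nat.cast_pos.2 (Nat.pos_of_ne_zero hx)⟩

theorem excess_eq : excess α μ v = ∑ x, α x * (v x : ℝ) - μ * ∑ x, (v x : ℝ) := by
  simp only [excess, sub_mul, Finset.sum_sub_distrib, Finset.mul_sum]

theorem excess_dimSlope (hv : v ≠ 0) : excess α (dimSlope α v) v = 0 := by
  rw [excess_eq, dimSlope, div_mul_cancel₀ _ (sum_cast_pos hv).ne', sub_self]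

theorem excess_nonpos_iff (hv : v ≠ 0) : excess α μ v ≤ 0 ↔ dimSlope α v ≤ μ := by
  rw [excess_eq, sub_nonpos, dimSlope, div_le_iff₀ (sum_cast_pos hv)]

theorem excess_neg_iff (hv : v ≠ 0) : excess α μ v < 0 ↔ dimSlope α v < μ := by
  rw [excess_eq, sub_neg, dimSlope, div_lt_iff₀ (sum_cast_pos hv)]

end Slope

end QuiverRep

/-! ### Truncations and the Harder-Narasimhan type -/

namespace QuiverRep

variable {K : Type u} [Field K] {Q : Type v} [Quiver.{w} Q] [Fintype Q] {V W : QuiverRep K Q}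
  {α : Q → ℝ} {μ : ℝ}

namespace SubRep

variable {T U X Y S : SubRep V}

theorem excess_subquotient_add (h : T ≤ U) :
    excess α μ (T.subquotient U).dimVec + excess α μ T.dim = excess α μ U.dim := by
  rw [← excess_add, dimVec_subquotient_add_dim h]

theorem excess_sup_add_excess_inf (X Y : SubRep V) :
    excess α μ (X ⊔ Y).dim + excess α μ (X ⊓ Y).dim = excess α μ X.dim + excess α μ Y.dim := by
  rw [← excess_add, ← excess_add, dim_sup_add_dim_inf]

theorem isSemistable_subquotient_iff (h : T < U) :
    IsSemistable α (T.subquotient U) ↔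
      ∀ X, T < X → X ≤ U → slope α (T.subquotient X) ≤ slope α (T.subquotient U) := by
  constructor
  · rintro ⟨-, hss⟩ X hTX hXU
    obtain ⟨P, hP⟩ := exists_subRep_subquotient hTX.le hXU
    have hslope : slope α P.toRep = slope α (T.subquotient X) := congrArg (dimSlope α) hP
    exact hslope ▸ hss P
      (isNonzero_iff_dimVec_ne_zero.2 (hP.trans_ne (dimVec_subquotient_ne_zero hTX)))
  · intro hle
    refine ⟨isNonzero_iff_dimVec_ne_zero.2 (dimVec_subquotient_ne_zero h), fun P hP => ?_⟩
    obtain ⟨X, hTX, hXU, hX⟩ := exists_between_of_subRep_subquotient h.le P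
    have hne : T ≠ X := by
      rintro rfl
      have hzero : (T.subquotient T).dimVec = 0 :=
        add_eq_right.1 (dimVec_subquotient_add_dim le_rfl)
      exact isNonzero_iff_dimVec_ne_zero.1 hP (hX.symm.trans hzero)
    have hslope : slope α (T.subquotient X) = slope α P.toRep := congrArg (dimSlope α) hX
    exact hslope ▸ hle X (hTX.lt_of_ne hne) hXU

theorem excess_le_of_isSemistable (hTU : T < U) (hss : IsSemistable α (T.subquotient U))
    (hμ : μ ≤ slope α (T.subquotient U)) (hTY : T ≤ Y) (hYU : Y ≤ U) :
    excess α μ Y.dim ≤ excess α μ U.dim := by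
  set s := slope α (T.subquotient U)
  have hU : excess α s (T.subquotient U).dimVec = 0 :=
    excess_dimSlope (dimVec_subquotient_ne_zero hTU)
  have hY : excess α s Y.dim ≤ excess α s T.dim := by
    obtain rfl | hlt := hTY.eq_or_lt
    · rfl
    · linarith [excess_subquotient_add (α := α) (μ := s) hTY, (excess_nonpos_iff
        (dimVec_subquotient_ne_zero hlt)).2 ((isSemistable_subquotient_iff hTU).1 hss Y hlt hYU)]
  have hquot : 0 ≤ excess α s (Y.subquotient U).dimVec := by
    linarith [excess_subquotient_add (α := α) (μ := s) hTU.le,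
      excess_subquotient_add (α := α) (μ := s) hYU]
  linarith [excess_subquotient_add (α := α) (μ := μ) hYU,
    excess_antitone (α := α) (v := (Y.subquotient U).dimVec) hμ]

theorem excess_lt_of_isSemistable (hTU : T < U) (hss : IsSemistable α (T.subquotient U))
    (hμ : slope α (T.subquotient U) < μ) (hTY : T < Y) (hYU : Y ≤ U) :
    excess α μ Y.dim < excess α μ T.dim := by
  have hslope : dimSlope α (T.subquotient Y).dimVec < μ :=
    ((isSemistable_subquotient_iff hTU).1 hss Y hTY hYU).trans_lt hμ
  linarith [excess_subquotient_add (α := α) (μ := μ) hTY.le,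
    (excess_neg_iff (dimVec_subquotient_ne_zero hTY)).2 hslope]

/-- `T` is the largest maximiser of `excess α μ` among the subrepresentations of `U`. It is the
term of the Harder-Narasimhan filtration of `U` that collects the subquotients of slope `≥ μ`. -/
structure IsTruncation (α : Q → ℝ) (μ : ℝ) (U T : SubRep V) : Prop where
  le : T ≤ U
  excess_le : ∀ X ≤ U, excess α μ X.dim ≤ excess α μ T.dim
  le_of_excess_le : ∀ X ≤ U, excess α μ T.dim ≤ excess α μ X.dim → X ≤ T

namespace IsTruncation

theorem unique (hS : IsTruncation α μ U S) (hT : IsTruncation α μ U T) : S = T :=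
  le_antisymm (hT.le_of_excess_le S hS.le (hS.excess_le T hT.le))
    (hS.le_of_excess_le T hT.le (hT.excess_le S hS.le))

theorem bot : IsTruncation α μ (⊥ : SubRep V) ⊥ where
  le := le_rfl
  excess_le _ hX := (congrArg (fun X => excess α μ X.dim) (le_bot_iff.1 hX)).le
  le_of_excess_le _ hX _ := hX

theorem of_le_slope (hT : IsTruncation α μ T T) (hTU : T < U)
    (hss : IsSemistable α (T.subquotient U)) (hμ : μ ≤ slope α (T.subquotient U)) :
    IsTruncation α μ U U where
  le := le_rfl
  excess_le X hX := by
    have hsup : excess α μ (X ⊔ T).dim ≤ excess α μ U.dim :=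
      excess_le_of_isSemistable hTU hss hμ le_sup_right (sup_le hX hTU.le)
    linarith [excess_sup_add_excess_inf (α := α) (μ := μ) X T, hT.excess_le (X ⊓ T) inf_le_right]
  le_of_excess_le _ hX _ := hX

theorem of_slope_lt (hS : IsTruncation α μ T S) (hTU : T < U)
    (hss : IsSemistable α (T.subquotient U)) (hμ : slope α (T.subquotient U) < μ) :
    IsTruncation α μ U S := by
  have hlt : ∀ X ≤ U, ¬ X ≤ T → excess α μ X.dim < excess α μ S.dim := fun X hXU hXT => by
    have hsup : excess α μ (X ⊔ T).dim < excess α μ T.dim :=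
      excess_lt_of_isSemistable hTU hss hμ (right_lt_sup.2 hXT) (sup_le hXU hTU.le)
    linarith [excess_sup_add_excess_inf (α := α) (μ := μ) X T, hS.excess_le (X ⊓ T) inf_le_right]
  refine ⟨hS.le.trans hTU.le, fun X hXU => ?_, fun X hXU hle => ?_⟩
  · by_cases hXT : X ≤ T
    · exact hS.excess_le X hXT
    · exact (hlt X hXU hXT).le
  · exact hS.le_of_excess_le X (not_imp_comm.1 (hlt X hXU) hle.not_gt) hle

end IsTruncation

end SubRep

open SubRep

section Existence

variable (α)

theorem exists_maximal_destabilizing {T : SubRep V} (hT : T < ⊤) :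
    ∃ X, T < X ∧ IsSemistable α (T.subquotient X) ∧
      ∀ Y, X < Y → slope α (X.subquotient Y) < slope α (T.subquotient X) := by
  have hfin : ((fun X : SubRep V => (T.subquotient X).dimVec) '' Set.Ioi T).Finite := by
    classical
    refine (Set.finite_Iic (⊤ : SubRep V).dim).subset ?_
    rintro _ ⟨X, hX, rfl⟩
    exact le_self_add.trans
      ((dimVec_subquotient_add_dim hX.le).trans_le (dim_mono le_top))
  obtain ⟨_, ⟨X, hX : T < X, rfl⟩, hmax⟩ := Set.exists_max_image _
    (fun v : Q → ℕ => toLex (dimSlope α v, ∑ x, v x)) hfin ⟨_, ⊤, hT, rfl⟩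
  have hmax (Y) (hY : T < Y) : slope α (T.subquotient Y) < slope α (T.subquotient X) ∨
      slope α (T.subquotient Y) = slope α (T.subquotient X) ∧
        ∑ x, (T.subquotient Y).dimVec x ≤ ∑ x, (T.subquotient X).dimVec x :=
    Prod.Lex.toLex_le_toLex.1 (hmax _ ⟨Y, hY, rfl⟩)
  refine ⟨X, hX, (isSemistable_subquotient_iff hX).2 fun Y hY _ =>
    (hmax Y hY).elim le_of_lt fun h => h.1.le, fun Y hXY => ?_⟩
  set s := slope α (T.subquotient X)
  have hadd := dimVec_subquotient_add_dimVec_subquotient hX.le hXY.le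
  have hYs : dimSlope α (T.subquotient Y).dimVec < s := by
    refine (hmax Y (hX.trans hXY)).resolve_right fun h => h.2.not_gt ?_
    rw [← hadd]
    exact Fintype.sum_strictMono
      (lt_add_of_pos_left _ (pos_iff_ne_zero.2 (dimVec_subquotient_ne_zero hXY)))
  have hXs : excess α s (T.subquotient X).dimVec = 0 :=
    excess_dimSlope (dimVec_subquotient_ne_zero hX)
  rw [← excess_neg_iff (dimVec_subquotient_ne_zero (hX.trans hXY)), ← hadd, excess_add, hXs,
    add_zero] at hYs
  exact (excess_neg_iff (dimVec_subquotient_ne_zero hXY)).1 hYs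

theorem nonempty_hnFiltration (V : QuiverRep K Q) : Nonempty (HNFiltration α V) := by
  have hstep (T : SubRep V) : ∃ X, T < ⊤ → T < X ∧ IsSemistable α (T.subquotient X) ∧
      ∀ Y, X < Y → slope α (X.subquotient Y) < slope α (T.subquotient X) := by
    by_cases hT : T < ⊤
    · exact (exists_maximal_destabilizing α hT).imp fun _ h _ => h
    · exact ⟨T, fun h => absurd h hT⟩
  choose f hf using hstep
  let g (t : ℕ) : SubRep V := f^[t] ⊥
  have hg (t) : g (t + 1) = f (g t) := Function.iterate_succ_apply' f t ⊥
  have hex : ∃ n, g n = ⊤ := by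
    by_contra! hne
    have hmono : StrictMono g := strictMono_nat_of_lt_succ fun t =>
      hg t ▸ (hf (g t) (hne t).lt_top).1
    exact Set.infinite_of_injective_forall_mem (dim_strictMono.comp hmono).injective
      (fun t => Set.mem_range_self (g t)) finite_range_dim
  classical
  let n := Nat.find hex
  have hlt {t} (ht : t < n) : g t < ⊤ := lt_top_iff_ne_top.2 (Nat.find_min hex ht)
  have hslope : StrictAntiOn (fun t => slope α ((g t).subquotient (g (t + 1)))) (Set.Iio n) := by
    refine strictAntiOn_of_add_one_lt Set.ordConnected_Iio fun t _ ht ht' => ?_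
    simp only [hg]
    exact (hf _ (hlt ht)).2.2 _ (hg t ▸ (hf _ (hlt ht')).1)
  exact ⟨{
    length := n
    step i := g i
    step_zero := rfl
    step_last := Nat.find_spec hex
    step_lt i := hg i ▸ (hf (g i) (hlt i.2)).1
    semistable i := hg i ▸ (hf (g i) (hlt i.2)).2.1
    slope_lt i j hij := hslope i.2 j.2 hij }⟩

end Existence

section UpperSum

variable {M R : Type*} [AddCommMonoid M] [LinearOrder R] {s : M → R} {l l' : List M} {a b : M}

/-- The sum of the entries of a list at which `s` takes a value `≥ r`. -/
def upperSum (s : M → R) (r : R) (l : List M) : M :=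
  (l.map fun a => if r ≤ s a then a else 0).sum

theorem upperSum_cons (s : M → R) (r : R) (a : M) (l : List M) :
    upperSum s r (a :: l) = (if r ≤ s a then a else 0) + upperSum s r l := rfl

theorem upperSum_concat (s : M → R) (r : R) (l : List M) (a : M) :
    upperSum s r (l ++ [a]) = upperSum s r l + if r ≤ s a then a else 0 := by
  simp only [upperSum, List.map_append, List.map_singleton, List.sum_append, List.sum_singleton]

theorem upperSum_eq_zero {r : R} (h : ∀ a ∈ l, s a < r) : upperSum s r l = 0 :=
  List.sum_eq_zero fun _ hb => by
    obtain ⟨a, ha, rfl⟩ := List.mem_map.1 hb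
    exact if_neg (h a ha).not_ge

theorem upperSum_self_cons (h : ∀ b ∈ l, s b < s a) : upperSum s (s a) (a :: l) = a := by
  rw [upperSum_cons, if_pos le_rfl, upperSum_eq_zero h, add_zero]

theorem not_lt_of_upperSum_eq (ha : a ≠ 0) (hl : ∀ c ∈ l, s c < s a) (hl' : ∀ c ∈ l', s c < s b)
    (h : upperSum s (s a) (a :: l) = upperSum s (s a) (b :: l')) : ¬ s b < s a := fun hba => by
  rw [upperSum_self_cons hl, upperSum_eq_zero
    (List.forall_mem_cons.2 ⟨hba, fun c hc => (hl' c hc).trans hba⟩)] at h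
  exact ha h

theorem eq_of_upperSum_eq [IsLeftCancelAdd M] :
    ∀ {l l' : List M}, (∀ a ∈ l, a ≠ 0) → (∀ a ∈ l', a ≠ 0) →
      l.Pairwise (fun a b => s b < s a) → l'.Pairwise (fun a b => s b < s a) →
      (∀ r, upperSum s r l = upperSum s r l') → l = l'
  | [], [], _, _, _, _, _ => rfl
  | a :: l, [], h0, _, hl, _, h => by
    rw [List.pairwise_cons] at hl
    exact absurd ((upperSum_self_cons hl.1).symm.trans (h (s a))) (h0 a List.mem_cons_self)
  | [], b :: l', _, h0', _, hl', h => by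
    rw [List.pairwise_cons] at hl'
    exact absurd ((upperSum_self_cons hl'.1).symm.trans (h (s b)).symm)
      (h0' b List.mem_cons_self)
  | a :: l, b :: l', h0, h0', hl, hl', h => by
    rw [List.forall_mem_cons] at h0 h0'
    rw [List.pairwise_cons] at hl hl'
    have hs : s a = s b := le_antisymm
      (not_lt.1 (not_lt_of_upperSum_eq h0.1 hl.1 hl'.1 (h _)))
      (not_lt.1 (not_lt_of_upperSum_eq h0'.1 hl'.1 hl.1 (h _).symm))
    obtain rfl : a = b := by
      rw [← upperSum_self_cons hl.1, h, hs, upperSum_self_cons hl'.1]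
    rw [eq_of_upperSum_eq h0.2 h0'.2 hl.2 hl'.2 fun r => add_left_cancel (h r)]

end UpperSum

namespace HNFiltration

theorem ne_zero_of_mem_type (F : HNFiltration α V) : ∀ v ∈ F.type, v ≠ 0 := by
  intro v hv
  obtain ⟨i, rfl⟩ := List.mem_ofFn.1 hv
  exact dimVec_subquotient_ne_zero (F.step_lt i)

theorem pairwise_type (F : HNFiltration α V) :
    F.type.Pairwise fun v w => dimSlope α w < dimSlope α v :=
  List.pairwise_ofFn.2 fun i j => F.slope_lt i j

theorem take_type_succ (F : HNFiltration α V) (k : Fin F.length) :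
    F.type.take (k + 1) =
      F.type.take k ++ [((F.step k.castSucc).subquotient (F.step k.succ)).dimVec] := by
  rw [List.take_succ_eq_append_getElem ((List.length_ofFn (f := _)).symm ▸ k.2)]
  simp only [type, List.getElem_ofFn]

theorem exists_isTruncation_step (F : HNFiltration α V) (μ : ℝ) (k : Fin (F.length + 1)) :
    ∃ T, IsTruncation α μ (F.step k) T ∧
      T.dim = upperSum (dimSlope α) μ (F.type.take k) ∧
      ((∀ v ∈ F.type.take k, μ ≤ dimSlope α v) → T = F.step k) := by
  induction k using Fin.induction with
  | zero => exact ⟨⊥, by rw [F.step_zero]; exact .bot, dim_bot, fun _ => F.step_zero.symm⟩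
  | succ k ih =>
    obtain ⟨T, hT, hdim, heq⟩ := ih
    have htake := F.take_type_succ k
    rw [Fin.val_succ, htake]
    rw [Fin.val_castSucc] at hdim heq
    set d := ((F.step k.castSucc).subquotient (F.step k.succ)).dimVec
    by_cases hμ : μ ≤ dimSlope α d
    · have hslope : ∀ v ∈ F.type.take k, μ ≤ dimSlope α v := fun v hv =>
        have hpw := htake ▸ F.pairwise_type.take (i := k + 1)
        hμ.trans ((List.pairwise_append.1 hpw).2.2 v hv d List.mem_cons_self).le
      obtain rfl := heq hslope
      refine ⟨F.step k.succ, hT.of_le_slope (F.step_lt k) (F.semistable k) hμ, ?_, fun _ => rfl⟩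
      rw [upperSum_concat, if_pos hμ, ← hdim, add_comm,
        dimVec_subquotient_add_dim (F.step_lt k).le]
    · refine ⟨T, hT.of_slope_lt (F.step_lt k) (F.semistable k) (not_le.1 hμ), ?_,
        fun h => absurd (h d List.mem_concat_self) hμ⟩
      rw [upperSum_concat, if_neg hμ, add_zero, hdim]

theorem dim_eq_upperSum_type (F : HNFiltration α V) {T : SubRep V} (hT : IsTruncation α μ ⊤ T) :
    T.dim = upperSum (dimSlope α) μ F.type := by
  obtain ⟨S, hS, hdim, -⟩ := F.exists_isTruncation_step μ (Fin.last _)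
  rw [F.step_last] at hS
  rwa [hT.unique hS, ← F.type.take_of_length_le (List.length_ofFn (f := _)).le]

end HNFiltration

theorem exists_hnType_eq (α : Q → ℝ) (V : QuiverRep K Q) :
    ∃ F : HNFiltration α V, hnType α V = F.type :=
  ⟨_, dif_pos (nonempty_hnFiltration α V)⟩

theorem dim_eq_of_hnType_eq (h : hnType α V = hnType α W) {S : SubRep V} {T : SubRep W}
    (hS : IsTruncation α μ ⊤ S) (hT : IsTruncation α μ ⊤ T) : S.dim = T.dim := by
  obtain ⟨F, hF⟩ := exists_hnType_eq α V
  obtain ⟨G, hG⟩ := exists_hnType_eq α W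
  rw [F.dim_eq_upperSum_type hS, G.dim_eq_upperSum_type hT, ← hF, ← hG, h]

theorem hnType_eq_of_isTruncation {S : ℝ → SubRep V} {T : ℝ → SubRep W}
    (hS : ∀ μ, IsTruncation α μ ⊤ (S μ)) (hT : ∀ μ, IsTruncation α μ ⊤ (T μ))
    (h : ∀ μ, (S μ).dim = (T μ).dim) : hnType α V = hnType α W := by
  obtain ⟨F, hF⟩ := exists_hnType_eq α V
  obtain ⟨G, hG⟩ := exists_hnType_eq α W
  rw [hF, hG]
  refine eq_of_upperSum_eq F.ne_zero_of_mem_type G.ne_zero_of_mem_type F.pairwise_type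
    G.pairwise_type fun μ => ?_
  rw [← F.dim_eq_upperSum_type (hS μ), ← G.dim_eq_upperSum_type (hT μ), h]

end QuiverRep

/-! ### Ascending representations -/

namespace QuiverRep

open SubRep

variable {K : Type u} [Field K] {Q : Type v} [Quiver.{w} Q] {V W : QuiverRep K Q} {α : Q → ℝ}

/-- `α` does not decrease along any edge on which `V` is nonzero. -/
def IsAscending (α : Q → ℝ) (V : QuiverRep K Q) : Prop :=
  ∀ ⦃x y : Q⦄ (e : x ⟶ y), V.map e ≠ 0 → α x ≤ α y

/-- The subrepresentation of an ascending `V` supported on the vertices where `α` is at least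
`μ`. -/
noncomputable def superlevel (hV : IsAscending α V) (μ : ℝ) : SubRep V where
  sub x := if μ ≤ α x then ⊤ else ⊥
  le_comap {x y} e := by
    by_cases hx : μ ≤ α x
    · by_cases he : V.map e = 0
      · rw [he, Submodule.comap_zero]
        exact le_top
      · rw [if_pos (hx.trans (hV e he)), Submodule.comap_top]
        exact le_top
    · rw [if_neg hx]
      exact bot_le

theorem dim_superlevel (hV : IsAscending α V) (μ : ℝ) (x : Q) :
    (superlevel hV μ).dim x = if μ ≤ α x then V.dimVec x else 0 := by
  change Module.finrank K (if μ ≤ α x then ⊤ else ⊥ : Submodule K (V.obj x)) = _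
  by_cases hx : μ ≤ α x
  · rw [if_pos hx, if_pos hx, finrank_top, dimVec]
  · rw [if_neg hx, if_neg hx, finrank_bot]

/-- The representation with a line at every vertex and multiplication by `c e` along `e`. -/
def thinRep (c : ∀ ⦃x y : Q⦄, (x ⟶ y) → K) : QuiverRep K Q where
  obj _ := K
  map e := LinearMap.mulLeft K (c e)

theorem thinRep_map_eq_zero_iff {c : ∀ ⦃x y : Q⦄, (x ⟶ y) → K} {x y : Q} (e : x ⟶ y) :
    (thinRep c).map e = 0 ↔ c e = 0 :=
  LinearMap.mulLeft_eq_zero_iff K K (c e)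

theorem Iso.map_eq_zero (φ : Iso V W) {x y : Q} {e : x ⟶ y} (he : W.map e = 0) : V.map e = 0 :=
  LinearMap.ext fun a => (φ.app y).map_eq_zero_iff.1 <| by
    rw [φ.comm, he, LinearMap.zero_apply]

variable [Fintype Q]

theorem isTruncation_superlevel (hV : IsAscending α V) (μ : ℝ) :
    IsTruncation α μ ⊤ (superlevel hV μ) := by
  have hle (X : SubRep V) (x : Q) :
      (α x - μ) * (X.dim x : ℝ) ≤ (α x - μ) * ((superlevel hV μ).dim x : ℝ) := by
    rw [dim_superlevel]
    split_ifs with hx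
    · exact mul_le_mul_of_nonneg_left (mod_cast dim_top (V := V) ▸ dim_mono le_top x)
        (sub_nonneg.2 hx)
    · rw [Nat.cast_zero, mul_zero]
      exact mul_nonpos_of_nonpos_of_nonneg (sub_nonpos.2 (not_le.1 hx).le) (Nat.cast_nonneg _)
  refine ⟨le_top, fun X _ => Finset.sum_le_sum fun x _ => hle X x, fun X _ hX x => ?_⟩
  have heq : (α x - μ) * (X.dim x : ℝ) = (α x - μ) * ((superlevel hV μ).dim x : ℝ) :=
    (Finset.sum_eq_sum_iff_of_le fun x _ => hle X x).1
      (le_antisymm (Finset.sum_le_sum fun x _ => hle X x) hX) x (Finset.mem_univ x)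
  change X.sub x ≤ if μ ≤ α x then ⊤ else ⊥
  rw [dim_superlevel] at heq
  split_ifs at heq ⊢ with hx
  · exact le_top
  · rw [Nat.cast_zero, mul_zero, mul_eq_zero, sub_eq_zero, Nat.cast_eq_zero] at heq
    exact (Submodule.finrank_eq_zero.1 (heq.resolve_left (not_le.1 hx).ne)).le

theorem hnType_eq_of_dimVec_eq (hV : IsAscending α V) (hW : IsAscending α W)
    (h : V.dimVec = W.dimVec) : hnType α V = hnType α W :=
  hnType_eq_of_isTruncation (isTruncation_superlevel hV) (isTruncation_superlevel hW) fun μ =>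
    funext fun x => by rw [dim_superlevel, dim_superlevel, h]

theorem IsComplete.lt_of_edge (h : IsComplete K {α}) {x y : Q} (e : x ⟶ y) : α y < α x := by
  by_contra! hxy
  let c ⦃x y : Q⦄ (_ : x ⟶ y) : K := if α x ≤ α y then 1 else 0
  let V : QuiverRep K Q := thinRep c
  let W : QuiverRep K Q := thinRep fun _ _ _ => 0
  have hV : IsAscending α V := fun _ _ e he =>
    by_contra fun hle => he ((thinRep_map_eq_zero_iff e).2 (if_neg hle))
  have hW : IsAscending α W := fun _ _ e he => absurd ((thinRep_map_eq_zero_iff e).2 rfl) he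
  obtain ⟨φ⟩ := h V W fun β hβ => Set.mem_singleton_iff.1 hβ ▸ hnType_eq_of_dimVec_eq hV hW rfl
  have hce : c e = 0 :=
    (thinRep_map_eq_zero_iff e).1 (φ.map_eq_zero ((thinRep_map_eq_zero_iff e).2 rfl))
  exact one_ne_zero ((if_pos hxy).symm.trans hce)

end QuiverRep

/-! ### Barcodes of persistence modules -/

namespace QuiverRep

open SubRep OrdinaryQuiver

variable {K : Type u} [Field K] {ℓ : ℕ} {V W : QuiverRep K (OrdinaryQuiver ℓ)}

/-- The structure map `V_{x_i} → V_{x_{i+1}}` of a persistence module. -/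
def next (V : QuiverRep K (OrdinaryQuiver ℓ)) (i : Fin ℓ) :
    V.obj (x i.castSucc) →ₗ[K] V.obj (x i.succ) :=
  V.map (Edge.edge i)

theorem exists_family_single {n : ℕ} {M : Fin n → Type*} [∀ i, Zero (M i)] (a : Fin n) (v : M a) :
    ∃ f : ∀ i, M i, f a = v ∧ ∀ i ≠ a, f i = 0 :=
  ⟨Pi.single a v, Pi.single_eq_same a v, fun _ h => Pi.single_eq_of_ne h v⟩

theorem exists_trajectory (a : Fin (ℓ + 1)) (v : V.obj (x a)) :
    ∃ p : ∀ i, V.obj (x i), p a = v ∧ (∀ i < a, p i = 0) ∧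
      ∀ i : Fin ℓ, a ≤ i.castSucc → V.next i (p i.castSucc) = p i.succ := by
  obtain ⟨source, hsame, hne⟩ : ∃ source : ∀ i, V.obj (x i),
      source a = v ∧ ∀ i ≠ a, source i = 0 :=
    exists_family_single (M := fun i => V.obj (x i)) a v
  let p (i : Fin (ℓ + 1)) : V.obj (x i) :=
    Fin.induction (motive := fun i => V.obj (x i)) (source 0)
      (fun i q => source i.succ + V.next i q) i
  have hsucc (i : Fin ℓ) : p i.succ = source i.succ + V.next i (p i.castSucc) := rfl
  have hlt (i) : i < a → p i = 0 := by
    induction i using Fin.induction with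
    | zero => exact fun h => hne 0 h.ne
    | succ i ih =>
      intro h
      rw [hsucc, ih (Fin.castSucc_lt_succ.trans h), map_zero, add_zero, hne _ h.ne]
  refine ⟨p, ?_, hlt, fun i hi => ?_⟩
  · obtain rfl | ⟨j, rfl⟩ := a.eq_zero_or_eq_succ
    · exact hsame
    · rw [hsucc, hlt _ Fin.castSucc_lt_succ, map_zero, add_zero, hsame]
  · rw [hsucc, hne _ (hi.trans_lt Fin.castSucc_lt_succ).ne', zero_add]

theorem exists_cotrajectory (b : Fin (ℓ + 1)) (η : V.obj (x b) →ₗ[K] K) :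
    ∃ ξ : ∀ i, V.obj (x i) →ₗ[K] K, ξ b = η ∧ (∀ i, b < i → ξ i = 0) ∧
      ∀ i : Fin ℓ, i.succ ≤ b → ξ i.succ ∘ₗ V.next i = ξ i.castSucc := by
  obtain ⟨source, hsame, hne⟩ : ∃ source : ∀ i, V.obj (x i) →ₗ[K] K,
      source b = η ∧ ∀ i ≠ b, source i = 0 :=
    exists_family_single (M := fun i => V.obj (x i) →ₗ[K] K) b η
  let ξ (i : Fin (ℓ + 1)) : V.obj (x i) →ₗ[K] K :=
    Fin.reverseInduction (motive := fun i => V.obj (x i) →ₗ[K] K) (source (Fin.last ℓ))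
      (fun i θ => source i.castSucc + θ ∘ₗ V.next i) i
  have hlast : ξ (Fin.last ℓ) = source (Fin.last ℓ) := Fin.reverseInduction_last
  have hcast (i : Fin ℓ) : ξ i.castSucc = source i.castSucc + ξ i.succ ∘ₗ V.next i :=
    Fin.reverseInduction_castSucc i
  have hlt (i) : b < i → ξ i = 0 := by
    induction i using Fin.reverseInduction with
    | last => exact fun h => hlast.trans (hne _ h.ne')
    | cast i ih =>
      intro h
      rw [hcast, ih (h.trans Fin.castSucc_lt_succ), LinearMap.zero_comp, add_zero,
        hne _ h.ne']
  refine ⟨ξ, ?_, hlt, fun i hi => ?_⟩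
  · obtain ⟨j, rfl⟩ | rfl := b.eq_castSucc_or_eq_last
    · rw [hcast, hlt _ Fin.castSucc_lt_succ, LinearMap.zero_comp, add_zero, hsame]
    · exact hlast.trans hsame
  · rw [hcast, hne _ (Fin.castSucc_lt_succ.trans_le hi).ne, zero_add]

/-- A direct summand of `V` isomorphic to the interval module on `[birth, death]`: the inclusion
sends the basis vector at `x_i` to `vec i`, and the projection is `coord`. -/
structure IntervalSummand (V : QuiverRep K (OrdinaryQuiver ℓ)) where
  birth : Fin (ℓ + 1)
  death : Fin (ℓ + 1)
  birth_le_death : birth ≤ death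
  vec : ∀ i, V.obj (x i)
  coord : ∀ i, V.obj (x i) →ₗ[K] K
  vec_eq_zero : ∀ i ∉ Finset.Icc birth death, vec i = 0
  coord_eq_zero : ∀ i ∉ Finset.Icc birth death, coord i = 0
  coord_vec : ∀ i ∈ Finset.Icc birth death, coord i (vec i) = 1
  next_vec : ∀ i : Fin ℓ, birth ≤ i.castSucc → V.next i (vec i.castSucc) = vec i.succ
  coord_next : ∀ i : Fin ℓ, i.succ ≤ death → coord i.succ ∘ₗ V.next i = coord i.castSucc

/-- The spanning vector is a trajectory issuing from the first nonzero vertex space; the coordinate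
functional is pulled back from the last vertex at which that trajectory is nonzero. -/
theorem nonempty_intervalSummand (hV : V.IsNonzero) : Nonempty (IntervalSummand V) := by
  obtain ⟨a, ha : Nontrivial (V.obj (x a)), hmin⟩ :=
    wellFounded_lt.has_min {i : Fin (ℓ + 1) | Nontrivial (V.obj (x i))} hV
  have hzero (i) (hi : i < a) (v : V.obj (x i)) : v = 0 :=
    have := not_nontrivial_iff_subsingleton.1 fun h => hmin i h hi
    Subsingleton.elim _ _
  obtain ⟨v, hv⟩ := exists_ne (0 : V.obj (x a))
  obtain ⟨p, hpa, -, hp⟩ := exists_trajectory a v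
  obtain ⟨b, hb : p b ≠ 0, hmax⟩ :=
    wellFounded_gt.has_min {i : Fin (ℓ + 1) | p i ≠ 0} ⟨a, hpa.trans_ne hv⟩
  obtain ⟨η, hη⟩ := Module.Projective.exists_dual_eq_one K hb
  obtain ⟨ξ, hξb, hξlt, hξ⟩ := exists_cotrajectory b η
  have hout {i} (hi : i ∉ Finset.Icc a b) : i < a ∨ b < i := by
    rwa [Finset.mem_Icc, not_and_or, not_le, not_le] at hi
  refine ⟨⟨a, b, le_of_not_gt fun h => hb (hzero b h _), p, ξ, fun i hi => ?_, fun i hi => ?_,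
    fun i => ?_, hp, hξ⟩⟩
  · exact (hout hi).elim (fun h => hzero i h _) fun h => by_contra fun hpi => hmax i hpi h
  · exact (hout hi).elim (fun h => LinearMap.ext fun w => by rw [hzero i h w, map_zero, map_zero])
      (hξlt i)
  · induction i using Fin.reverseInduction with
    | last =>
      intro hi
      obtain rfl := (Finset.mem_Icc.1 hi).2.antisymm (Fin.le_last b)
      rw [hξb, hη]
    | cast i ih =>
      intro hi
      obtain ⟨hai, hib⟩ := Finset.mem_Icc.1 hi
      obtain rfl | hlt := hib.eq_or_lt
      · rw [hξb, hη]
      · have hsucc : i.succ ≤ b := Fin.castSucc_lt_iff_succ_le.1 hlt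
        rw [← hξ i hsucc, LinearMap.comp_apply, hp i hai,
          ih (Finset.mem_Icc.2 ⟨hai.trans Fin.castSucc_lt_succ.le, hsucc⟩)]

namespace IntervalSummand

variable (I : IntervalSummand V)

/-- The composite `V → 𝕀 → W` through a common interval module is a morphism. -/
theorem coord_next_smul_vec {I : IntervalSummand V} {J : IntervalSummand W}
    (hbirth : I.birth = J.birth) (hdeath : I.death = J.death) (i : Fin ℓ)
    (v : V.obj (x i.castSucc)) :
    I.coord i.succ (V.next i v) • J.vec i.succ =
      I.coord i.castSucc v • W.next i (J.vec i.castSucc) := by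
  by_cases hi : J.birth ≤ i.castSucc
  · rw [J.next_vec i hi]
    by_cases hi' : i.succ ≤ J.death
    · rw [← I.coord_next i (hdeath ▸ hi'), LinearMap.comp_apply]
    · rw [J.vec_eq_zero _ fun h => hi' (Finset.mem_Icc.1 h).2, smul_zero, smul_zero]
  · rw [I.coord_eq_zero i.castSucc fun h => hi (hbirth ▸ (Finset.mem_Icc.1 h).1),
      LinearMap.zero_apply, zero_smul]
    by_cases hi' : i.succ ≤ J.death
    · rw [← LinearMap.comp_apply, I.coord_next i (hdeath ▸ hi'),
        I.coord_eq_zero i.castSucc fun h => hi (hbirth ▸ (Finset.mem_Icc.1 h).1),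
        LinearMap.zero_apply, zero_smul]
    · rw [J.vec_eq_zero _ fun h => hi' (Finset.mem_Icc.1 h).2, smul_zero]

theorem coord_mul_coord_vec (i : Fin (ℓ + 1)) (v : V.obj (x i)) :
    I.coord i v * I.coord i (I.vec i) = I.coord i v := by
  by_cases hi : i ∈ Finset.Icc I.birth I.death
  · rw [I.coord_vec i hi, mul_one]
  · rw [I.coord_eq_zero i hi, LinearMap.zero_apply, zero_mul]

theorem coord_vec_smul_vec (i : Fin (ℓ + 1)) : I.coord i (I.vec i) • I.vec i = I.vec i := by
  by_cases hi : i ∈ Finset.Icc I.birth I.death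
  · rw [I.coord_vec i hi, one_smul]
  · rw [I.vec_eq_zero i hi, smul_zero]

theorem coord_next_eq_zero {i : Fin ℓ} {v : V.obj (x i.castSucc)}
    (hv : I.coord i.castSucc v = 0) : I.coord i.succ (V.next i v) = 0 := by
  by_cases hi : i.succ ≤ I.death
  · rw [← LinearMap.comp_apply, I.coord_next i hi, hv]
  · rw [I.coord_eq_zero _ fun h => hi (Finset.mem_Icc.1 h).2, LinearMap.zero_apply]

/-- The complement of an interval summand, the kernel of the projection onto it. -/
def complement : SubRep V where
  sub i := LinearMap.ker (I.coord i)
  le_comap := by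
    rintro _ _ ⟨i⟩ v hv
    exact I.coord_next_eq_zero hv

/-- The inclusion of the complement of an interval summand. -/
def incl (i : Fin (ℓ + 1)) : I.complement.toRep.obj (x i) →ₗ[K] V.obj (x i) :=
  (I.complement.sub (x i)).subtype

/-- The projection onto the complement of an interval summand. -/
def proj (i : Fin (ℓ + 1)) : V.obj (x i) →ₗ[K] I.complement.toRep.obj (x i) :=
  LinearMap.codRestrict (I.complement.sub (x i))
    (LinearMap.id - (I.coord i).smulRight (I.vec i)) fun v => by
      change I.coord i (v - I.coord i v • I.vec i) = 0
      rw [map_sub, map_smul, smul_eq_mul, coord_mul_coord_vec, sub_self]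

theorem coord_incl (i : Fin (ℓ + 1)) (v : I.complement.toRep.obj (x i)) :
    I.coord i (I.incl i v) = 0 :=
  LinearMap.mem_ker.1 v.2

theorem incl_proj (i : Fin (ℓ + 1)) (v : V.obj (x i)) :
    I.incl i (I.proj i v) = v - I.coord i v • I.vec i := rfl

theorem incl_injective (i : Fin (ℓ + 1)) : Function.Injective (I.incl i) :=
  Subtype.val_injective

theorem proj_incl (i : Fin (ℓ + 1)) (v : I.complement.toRep.obj (x i)) :
    I.proj i (I.incl i v) = v :=
  I.incl_injective i <| by rw [incl_proj, coord_incl, zero_smul, sub_zero]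

theorem proj_vec (i : Fin (ℓ + 1)) : I.proj i (I.vec i) = 0 :=
  I.incl_injective i <| by rw [incl_proj, coord_vec_smul_vec, sub_self, map_zero]

theorem incl_next (i : Fin ℓ) (v : I.complement.toRep.obj (x i.castSucc)) :
    I.incl i.succ (I.complement.toRep.next i v) = V.next i (I.incl i.castSucc v) := rfl

theorem next_proj (i : Fin ℓ) (v : V.obj (x i.castSucc)) :
    I.complement.toRep.next i (I.proj i.castSucc v) = I.proj i.succ (V.next i v) :=
  I.incl_injective i.succ <| by
    rw [incl_next, incl_proj, incl_proj, map_sub, map_smul, coord_next_smul_vec rfl rfl]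

/-- An interval summand of the complement of `I`, regarded as an interval summand of `V`. -/
def ofComplement (J : IntervalSummand I.complement.toRep) : IntervalSummand V where
  birth := J.birth
  death := J.death
  birth_le_death := J.birth_le_death
  vec i := I.incl i (J.vec i)
  coord i := J.coord i ∘ₗ I.proj i
  vec_eq_zero i hi := by rw [J.vec_eq_zero i hi, map_zero]
  coord_eq_zero i hi := by rw [J.coord_eq_zero i hi, LinearMap.zero_comp]
  coord_vec i hi := by rw [LinearMap.comp_apply, proj_incl, J.coord_vec i hi]
  next_vec i hi := by rw [← incl_next, J.next_vec i hi]
  coord_next i hi := LinearMap.ext fun v => by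
    rw [← J.coord_next i hi]
    simp only [LinearMap.comp_apply, next_proj]

end IntervalSummand

/-- A decomposition of a persistence module as the direct sum of interval summands, expressed by the
duality and completeness relations between their vectors and coordinates. -/
structure Barcode (V : QuiverRep K (OrdinaryQuiver ℓ)) (ι : Type*) [Fintype ι] where
  bar : ι → IntervalSummand V
  coord_vec_of_ne : ∀ s t, s ≠ t → ∀ i, (bar s).coord i ((bar t).vec i) = 0
  sum_coord_smul_vec : ∀ i v, ∑ t, (bar t).coord i v • (bar t).vec i = v

/-- Adjoin an interval summand to a barcode of its complement. -/
def Barcode.cons {ι : Type*} [Fintype ι] (I : IntervalSummand V)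
    (B : Barcode I.complement.toRep ι) : Barcode V (Option ι) where
  bar t := t.elim I fun t => I.ofComplement (B.bar t)
  coord_vec_of_ne := by
    rintro (_ | s) (_ | t) hst i
    · exact absurd rfl hst
    · exact I.coord_incl i _
    · change (B.bar s).coord i (I.proj i (I.vec i)) = 0
      rw [I.proj_vec, map_zero]
    · change (B.bar s).coord i (I.proj i (I.incl i _)) = 0
      rw [I.proj_incl]
      exact B.coord_vec_of_ne s t (fun h => hst (congrArg some h)) i
  sum_coord_smul_vec i v := by
    rw [Fintype.sum_option]
    have hsum := congrArg (I.incl i) (B.sum_coord_smul_vec i (I.proj i v))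
    rw [map_sum, I.incl_proj] at hsum
    simp only [map_smul] at hsum
    exact (congrArg (I.coord i v • I.vec i + ·) hsum).trans (add_sub_cancel _ v)

theorem exists_barcode (V : QuiverRep K (OrdinaryQuiver ℓ)) :
    ∃ (ι : Type) (_ : Fintype ι), Nonempty (Barcode V ι) := by
  induction hn : ∑ i, V.dimVec i using Nat.strong_induction_on generalizing V with
  | _ n ih =>
  by_cases hV : V.IsNonzero
  · obtain ⟨I⟩ := nonempty_intervalSummand hV
    have hlt : I.complement < ⊤ := lt_top_iff_ne_top.2 fun h => by
      have hmem : I.vec I.birth ∈ I.complement.sub (x I.birth) := h ▸ Submodule.mem_top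
      exact one_ne_zero ((I.coord_vec _ (Finset.left_mem_Icc.2 I.birth_le_death)).symm.trans hmem)
    have hdim := Fintype.sum_strictMono (dim_top (V := V) ▸ dim_strictMono hlt)
    obtain ⟨ι, _, ⟨B⟩⟩ := ih _ (hn ▸ hdim) I.complement.toRep rfl
    exact ⟨Option ι, inferInstance, ⟨B.cons I⟩⟩
  · refine ⟨Empty, inferInstance, ⟨⟨Empty.elim, fun s => s.elim, fun i v => ?_⟩⟩⟩
    have := not_nontrivial_iff_subsingleton.1 fun h => hV ⟨x i, h⟩
    exact Subsingleton.elim _ _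

end QuiverRep

/-! ### Truncations of barcodes -/

namespace QuiverRep

open SubRep OrdinaryQuiver Finset
open scoped BigOperators

section Mean

variable {P : Type*} {f : P → ℝ}

theorem card_mul_expect_sub [DecidableEq P] {A B : Finset P} (hAB : A ⊆ B) :
    (#B : ℝ) * (𝔼 i ∈ B, f i - 𝔼 i ∈ A, f i) = ∑ j ∈ B \ A, (f j - 𝔼 i ∈ A, f i) := by
  have hsum (C : Finset P) : (#C : ℝ) * 𝔼 i ∈ C, f i = ∑ i ∈ C, f i := by
    rw [← nsmul_eq_mul, card_smul_expect]
  rw [mul_sub, hsum, sum_sub_distrib, sum_const, nsmul_eq_mul, card_sdiff_of_subset hAB,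
    Nat.cast_sub (card_le_card hAB), sub_mul, hsum, ← sum_sdiff hAB]
  ring

theorem expect_le_expect_of_subset {A B : Finset P} (hA : A.Nonempty) (hAB : A ⊆ B)
    (h : ∀ i ∈ A, ∀ j ∈ B, j ∉ A → f i ≤ f j) : 𝔼 i ∈ A, f i ≤ 𝔼 i ∈ B, f i := by
  classical
  have hB : (0 : ℝ) < #B := Nat.cast_pos.2 (hA.mono hAB).card_pos
  rw [← sub_nonneg, ← mul_nonneg_iff_of_pos_left hB, card_mul_expect_sub hAB]
  refine sum_nonneg fun j hj => sub_nonneg.2 (expect_le hA fun i hi => ?_)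
  exact h i hi j (mem_sdiff.1 hj).1 (mem_sdiff.1 hj).2

/-- The mean of `f` over the interval with endpoints `I.1` and `I.2`; this is the slope of the
interval module on `I` along the central charge `f`. -/
noncomputable def intervalMean [Preorder P] [LocallyFiniteOrder P] (f : P → ℝ) (I : P × P) : ℝ :=
  𝔼 i ∈ Icc I.1 I.2, f i

variable [LinearOrder P] [LocallyFiniteOrder P]

theorem intervalMean_lt (hf : StrictAnti f) {a b c : P} (hab : a ≤ b) (hbc : b < c) :
    intervalMean f (a, c) < intervalMean f (a, b) := by
  have hsub : Icc a b ⊆ Icc a c := Icc_subset_Icc_right hbc.le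
  have hne : (Icc a b).Nonempty := nonempty_Icc.2 hab
  have hcard : (0 : ℝ) < #(Icc a c) := Nat.cast_pos.2 (hne.mono hsub).card_pos
  rw [← sub_neg, ← smul_neg_iff_of_pos_left hcard, smul_eq_mul, intervalMean, intervalMean,
    card_mul_expect_sub hsub]
  have hmem : c ∈ Icc a c \ Icc a b :=
    mem_sdiff.2 ⟨right_mem_Icc.2 (hab.trans hbc.le), fun h => hbc.not_ge (mem_Icc.1 h).2⟩
  refine sum_neg (fun j hj => sub_neg.2 ?_) ⟨c, hmem⟩
  have hbj : b < j := by
    obtain ⟨hj, hj'⟩ := mem_sdiff.1 hj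
    exact not_le.1 fun h => hj' (mem_Icc.2 ⟨(mem_Icc.1 hj).1, h⟩)
  exact (hf hbj).trans_le (le_expect hne fun i hi => hf.antitone (mem_Icc.1 hi).2)

/-- Among the intervals through `I.1` whose mean is at least that of `I`, the interval `I` itself is
the lexicographically last one, so its multiplicity is found by recursion. -/
theorem card_filter_eq_of_card_filter_intervalMean_eq [Finite P] {ι κ : Type*} [Fintype ι]
    [Fintype κ] (hf : StrictAnti f) {p : ι → P × P} {q : κ → P × P}
    (h : ∀ μ i, #{t | μ ≤ intervalMean f (p t) ∧ i ∈ Icc (p t).1 (p t).2} =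
      #{t | μ ≤ intervalMean f (q t) ∧ i ∈ Icc (q t).1 (q t).2})
    {I : P × P} (hI : I.1 ≤ I.2) : #{t | p t = I} = #{t | q t = I} := by
  induction hL : toLex I using WellFoundedLT.induction generalizing I with
  | _ L ih =>
  subst hL
  have := Fintype.ofFinite P
  let S : Finset (P × P) := {J | intervalMean f I ≤ intervalMean f J ∧ I.1 ∈ Icc J.1 J.2}
  have hS {J} : J ∈ S ↔ intervalMean f I ≤ intervalMean f J ∧ I.1 ∈ Icc J.1 J.2 := mem_filter_univ J
  have hIS : I ∈ S := hS.2 ⟨le_rfl, left_mem_Icc.2 hI⟩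
  have hlast (J) (hJ : J ∈ S.erase I) : toLex J < toLex I := by
    obtain ⟨hne, hJ⟩ := mem_erase.1 hJ
    obtain ⟨hmean, hIJ⟩ := hS.1 hJ
    refine Prod.Lex.toLex_lt_toLex.2 ((mem_Icc.1 hIJ).1.lt_or_eq.imp_right fun heq => ⟨heq, ?_⟩)
    refine (not_lt.1 fun hlt => hmean.not_gt ?_).lt_of_ne fun h2 => hne (Prod.ext heq h2)
    rw [show J = (I.1, J.2) from Prod.ext heq rfl]
    exact intervalMean_lt hf hI hlt
  have hsum : ∑ J ∈ S, #{t | p t = J} = ∑ J ∈ S, #{t | q t = J} := by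
    simp only [sum_card_fiberwise_eq_card_filter, hS, h]
  rw [← add_sum_erase S _ hIS, ← add_sum_erase S _ hIS, sum_congr rfl fun J hJ =>
    ih _ (hlast J hJ) (nonempty_Icc.1 ⟨I.1, (hS.1 (mem_of_mem_erase hJ)).2⟩) rfl] at hsum
  exact add_right_cancel hsum

theorem dimSlope_indicator {Q : Type*} [Fintype Q] (α : Q → ℝ) (A : Finset Q) [DecidableEq Q] :
    dimSlope α (fun x => if x ∈ A then 1 else 0) = 𝔼 x ∈ A, α x := by
  simp only [dimSlope, Nat.cast_ite, Nat.cast_one, Nat.cast_zero, mul_ite, mul_one, mul_zero,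
    sum_ite_mem, univ_inter, expect_eq_sum_div_card, sum_const, nsmul_eq_mul]

end Mean

variable {K : Type u} [Field K] {ℓ : ℕ} {V W : QuiverRep K (OrdinaryQuiver ℓ)}
  {α : OrdinaryQuiver ℓ → ℝ} {μ : ℝ}

namespace IntervalSummand

variable (I : IntervalSummand V) (Y : SubRep V)

/-- The birth and death of an interval summand. -/
def endpoints : Fin (ℓ + 1) × Fin (ℓ + 1) := (I.birth, I.death)

open Classical in
/-- The vertices at which the projection of `Y` to the interval summand `I` is nonzero. -/
noncomputable def support : Finset (Fin (ℓ + 1)) :=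
  {i | ∃ v ∈ Y.sub (x i), I.coord i v ≠ 0}

variable {Y}

theorem mem_support {i : Fin (ℓ + 1)} :
    i ∈ I.support Y ↔ ∃ v ∈ Y.sub (x i), I.coord i v ≠ 0 := by
  classical exact mem_filter_univ i

theorem support_subset : I.support Y ⊆ Icc I.birth I.death := fun i hi => by
  obtain ⟨v, -, hv⟩ := I.mem_support.1 hi
  by_contra h
  exact hv (by rw [I.coord_eq_zero i h, LinearMap.zero_apply])

theorem mem_support_of_le {i j : Fin (ℓ + 1)} (hi : i ∈ I.support Y) (hij : i ≤ j)
    (hj : j ≤ I.death) : j ∈ I.support Y := by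
  induction j using Fin.induction with
  | zero => exact le_antisymm hij (Fin.zero_le i) ▸ hi
  | succ j ih =>
    obtain rfl | hlt := hij.eq_or_lt
    · exact hi
    · obtain ⟨v, hv, hne⟩ :=
        I.mem_support.1 (ih (Fin.le_castSucc_iff.2 hlt) (Fin.castSucc_lt_succ.le.trans hj))
      exact I.mem_support.2 ⟨V.next j v, Y.le_comap _ hv, by
        rwa [← LinearMap.comp_apply, I.coord_next j hj]⟩

end IntervalSummand

namespace Barcode

variable {ι : Type*} [Fintype ι] (B : Barcode V ι)

/-- The direct sum of the interval summands in `S`, cut out by the vanishing of the other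
coordinates. -/
def span (S : Finset ι) : SubRep V where
  sub i := ⨅ t, ⨅ _ : t ∉ S, LinearMap.ker ((B.bar t).coord i)
  le_comap := by
    rintro _ _ ⟨i⟩ v hv
    simp only [Submodule.mem_comap, Submodule.mem_iInf] at hv ⊢
    exact fun t ht => (B.bar t).coord_next_eq_zero (hv t ht)

variable {B} {S T : Finset ι} {t : ι} {X Y : SubRep V}

theorem mem_span {i : Fin (ℓ + 1)} {v : V.obj (x i)} :
    v ∈ (B.span S).sub (x i) ↔ ∀ t ∉ S, (B.bar t).coord i v = 0 := by
  simp only [span, Submodule.mem_iInf, LinearMap.mem_ker]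

theorem vec_mem_span (ht : t ∈ S) (i : Fin (ℓ + 1)) : (B.bar t).vec i ∈ (B.span S).sub (x i) :=
  mem_span.2 fun s hs => B.coord_vec_of_ne s t (fun h => hs (h ▸ ht)) i

theorem span_mono (h : S ⊆ T) : B.span S ≤ B.span T := fun _ _ hv =>
  mem_span.2 fun t ht => mem_span.1 hv t fun htS => ht (h htS)

theorem span_empty : B.span ∅ = ⊥ := le_bot_iff.1 fun i v hv => by
  rw [← B.sum_coord_smul_vec i v]
  exact sum_mem fun t _ => by rw [mem_span.1 hv t (notMem_empty t), zero_smul]; exact zero_mem _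

theorem span_univ : B.span univ = ⊤ := top_le_iff.1 fun _ _ _ =>
  mem_span.2 fun t ht => absurd (mem_univ t) ht

section Insert

variable [DecidableEq ι]

theorem dim_eq_dim_span_add (hX : B.span S ≤ X) (hX' : X ≤ B.span (insert t S)) (ht : t ∉ S)
    (i : Fin (ℓ + 1)) :
    X.dim (x i) = (if i ∈ (B.bar t).support X then 1 else 0) + (B.span S).dim (x i) := by
  let φ : X.sub (x i) →ₗ[K] K := (B.bar t).coord i ∘ₗ (X.sub (x i)).subtype
  have hker : LinearMap.ker φ = ((B.span S).sub (x i)).submoduleOf (X.sub (x i)) := by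
    refine Submodule.ext fun v =>
      ⟨fun hv => mem_span.2 fun s hs => ?_, fun hv => mem_span.1 hv t ht⟩
    obtain rfl | hst := eq_or_ne s t
    · exact hv
    · exact mem_span.1 (hX' _ v.2) s fun h => (mem_insert.1 h).elim hst hs
  have hrange : Module.finrank K (LinearMap.range φ) =
      if i ∈ (B.bar t).support X then 1 else 0 := by
    split_ifs with hi
    · obtain ⟨v, hv, hne⟩ := (B.bar t).mem_support.1 hi
      have hφ : φ ≠ 0 := fun h => hne (LinearMap.congr_fun h ⟨v, hv⟩)
      rw [LinearMap.range_eq_top.2 (LinearMap.surjective hφ), finrank_top, Module.finrank_self]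
    · have hφ : φ = 0 := LinearMap.ext fun v => by_contra fun hne =>
        hi ((B.bar t).mem_support.2 ⟨v, v.2, hne⟩)
      rw [hφ, LinearMap.range_zero, finrank_bot]
  have hrank := LinearMap.finrank_range_add_finrank_ker φ
  rw [hrange, hker, (Submodule.submoduleOfEquivOfLe (hX (x i))).finrank_eq] at hrank
  exact hrank.symm

theorem support_span_insert : (B.bar t).support (B.span (insert t S)) =
    Icc (B.bar t).birth (B.bar t).death :=
  (IntervalSummand.support_subset _).antisymm fun i hi => (B.bar t).mem_support.2
    ⟨(B.bar t).vec i, vec_mem_span (mem_insert_self t S) i,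
      ((B.bar t).coord_vec i hi).trans_ne one_ne_zero⟩

theorem slope_subquotient_span (hX : B.span S ≤ X) (hX' : X ≤ B.span (insert t S)) (ht : t ∉ S) :
    slope α ((B.span S).subquotient X) = 𝔼 i ∈ (B.bar t).support X, α (x i) := by
  have hdim : ((B.span S).subquotient X).dimVec =
      fun i : Fin (ℓ + 1) => if i ∈ (B.bar t).support X then 1 else 0 :=
    add_right_cancel (b := (B.span S).dim) <| (dimVec_subquotient_add_dim hX).trans <|
      funext (dim_eq_dim_span_add hX hX' ht)
  exact (congrArg (dimSlope α) hdim).trans (dimSlope_indicator (fun i => α (x i)) _)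

theorem slope_subquotient_span_insert (ht : t ∉ S) :
    slope α ((B.span S).subquotient (B.span (insert t S))) =
      intervalMean (fun i => α (x i)) (B.bar t).endpoints := by
  rw [slope_subquotient_span (span_mono (subset_insert t S)) le_rfl ht, support_span_insert]
  rfl

theorem span_lt_span_insert (ht : t ∉ S) : B.span S < B.span (insert t S) := by
  refine (span_mono (subset_insert t S)).lt_of_not_ge fun h => ?_
  have hzero := mem_span.1 (h _ (vec_mem_span (mem_insert_self t S) (B.bar t).birth)) t ht
  rw [(B.bar t).coord_vec _ (left_mem_Icc.2 (B.bar t).birth_le_death)] at hzero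
  exact one_ne_zero hzero

/-- The support of a nonzero subrepresentation of an interval module is a final segment, where `α`
takes its smallest values. -/
theorem isSemistable_subquotient_span_insert (hα : Antitone fun i : Fin (ℓ + 1) => α (x i))
    (ht : t ∉ S) : IsSemistable α ((B.span S).subquotient (B.span (insert t S))) := by
  refine (isSemistable_subquotient_iff (span_lt_span_insert ht)).2 fun X hX hX' => ?_
  rw [slope_subquotient_span hX.le hX' ht, slope_subquotient_span_insert ht]
  have hne : ((B.bar t).support X).Nonempty := by
    by_contra! hempty
    refine (dim_strictMono hX).ne (funext fun i : Fin (ℓ + 1) => ?_)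
    rw [dim_eq_dim_span_add hX.le hX' ht i, hempty, if_neg (notMem_empty i), zero_add]
  refine expect_le_expect_of_subset hne (IntervalSummand.support_subset _) fun i hi j hj hji => ?_
  exact hα (le_of_not_ge fun hij => hji
    ((B.bar t).mem_support_of_le hi hij (mem_Icc.1 hj).2))

end Insert

theorem isTruncation_span_self (hα : Antitone fun i : Fin (ℓ + 1) => α (x i))
    (hS : ∀ t ∈ S, μ ≤ intervalMean (fun i => α (x i)) (B.bar t).endpoints) :
    IsTruncation α μ (B.span S) (B.span S) := by
  classical
  induction S using Finset.induction with
  | empty => rw [span_empty]; exact .bot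
  | insert t S ht ih =>
    rw [forall_mem_insert] at hS
    exact (ih hS.2).of_le_slope (span_lt_span_insert ht)
      (isSemistable_subquotient_span_insert hα ht)
      (hS.1.trans_eq (slope_subquotient_span_insert ht).symm)

theorem isTruncation_span_union [DecidableEq ι] (hα : Antitone fun i : Fin (ℓ + 1) => α (x i))
    (hS : ∀ t ∈ S, μ ≤ intervalMean (fun i => α (x i)) (B.bar t).endpoints)
    (hT : ∀ t ∈ T, intervalMean (fun i => α (x i)) (B.bar t).endpoints < μ) :
    IsTruncation α μ (B.span (T ∪ S)) (B.span S) := by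
  induction T using Finset.induction with
  | empty => rw [empty_union]; exact isTruncation_span_self hα hS
  | insert t T ht ih =>
    rw [forall_mem_insert] at hT
    have ht' : t ∉ T ∪ S := notMem_union.2 ⟨ht, fun h => (hS t h).not_gt hT.1⟩
    rw [insert_union]
    exact (ih hT.2).of_slope_lt (span_lt_span_insert ht')
      (isSemistable_subquotient_span_insert hα ht')
      ((slope_subquotient_span_insert ht').trans_lt hT.1)

theorem isTruncation_span_filter (hα : Antitone fun i : Fin (ℓ + 1) => α (x i)) (μ : ℝ) :
    IsTruncation α μ ⊤
      (B.span {t | μ ≤ intervalMean (fun i => α (x i)) (B.bar t).endpoints}) := by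
  classical
  have h := isTruncation_span_union (B := B) (μ := μ)
    (S := {t | μ ≤ intervalMean (fun i => α (x i)) (B.bar t).endpoints})
    (T := {t | ¬ μ ≤ intervalMean (fun i => α (x i)) (B.bar t).endpoints}) hα
    (fun t ht => (mem_filter_univ t).1 ht) fun t ht => not_le.1 ((mem_filter_univ t).1 ht)
  rwa [union_comm, filter_union_filter_not_eq, span_univ] at h

theorem dim_span (S : Finset ι) (i : Fin (ℓ + 1)) :
    (B.span S).dim (x i) = #{t ∈ S | i ∈ Icc (B.bar t).birth (B.bar t).death} := by
  classical
  induction S using Finset.induction with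
  | empty => rw [span_empty, dim_bot]; rfl
  | insert t S ht ih =>
    rw [dim_eq_dim_span_add (span_mono (subset_insert t S)) le_rfl ht i, support_span_insert, ih,
      filter_insert]
    split_ifs with hi
    · rw [card_insert_of_notMem fun h => ht (mem_filter.1 h).1, add_comm]
    · rw [zero_add]

section Transfer

variable {κ : Type*} [Fintype κ] (B) (C : Barcode W κ)

/-- The map `V → W` carrying the bar `t` of `V` onto the bar `σ t` of `W`. -/
def transfer (σ : ι → κ) (i : Fin (ℓ + 1)) : V.obj (x i) →ₗ[K] W.obj (x i) :=
  ∑ t, ((B.bar t).coord i).smulRight ((C.bar (σ t)).vec i)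

variable {B C}

theorem transfer_apply (σ : ι → κ) (i : Fin (ℓ + 1)) (v : V.obj (x i)) :
    B.transfer C σ i v = ∑ t, (B.bar t).coord i v • (C.bar (σ t)).vec i := by
  simp only [transfer, LinearMap.sum_apply, LinearMap.smulRight_apply]

theorem transfer_vec {σ : ι → κ} {t : ι} (ht : (C.bar (σ t)).endpoints = (B.bar t).endpoints)
    (i : Fin (ℓ + 1)) : B.transfer C σ i ((B.bar t).vec i) = (C.bar (σ t)).vec i := by
  rw [transfer_apply, sum_eq_single t
    (fun s _ hs => by rw [B.coord_vec_of_ne s t hs, zero_smul]) fun h => absurd (mem_univ t) h]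
  by_cases hi : i ∈ Icc (B.bar t).birth (B.bar t).death
  · rw [(B.bar t).coord_vec i hi, one_smul]
  · obtain ⟨hbirth, hdeath⟩ := Prod.mk.inj ht
    rw [(C.bar (σ t)).vec_eq_zero i (by rwa [hbirth, hdeath]), smul_zero]

theorem transfer_transfer {σ : ι ≃ κ} (hσ : ∀ t, (C.bar (σ t)).endpoints = (B.bar t).endpoints)
    (i : Fin (ℓ + 1)) (v : V.obj (x i)) :
    C.transfer B σ.symm i (B.transfer C σ i v) = v := by
  have hvec (t : ι) : C.transfer B σ.symm i ((C.bar (σ t)).vec i) = (B.bar t).vec i := by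
    rw [transfer_vec (by rw [σ.symm_apply_apply, hσ]), σ.symm_apply_apply]
  rw [transfer_apply σ, map_sum]
  simp only [map_smul, hvec, B.sum_coord_smul_vec]

theorem transfer_next {σ : ι → κ} (hσ : ∀ t, (C.bar (σ t)).endpoints = (B.bar t).endpoints)
    (i : Fin ℓ) (v : V.obj (x i.castSucc)) :
    B.transfer C σ i.succ (V.next i v) = W.next i (B.transfer C σ i.castSucc v) := by
  simp only [transfer_apply, map_sum, map_smul]
  exact sum_congr rfl fun t _ => IntervalSummand.coord_next_smul_vec
    (Prod.mk.inj (hσ t)).1.symm (Prod.mk.inj (hσ t)).2.symm i v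

/-- Barcodes with the same bars give isomorphic modules. -/
def iso (σ : ι ≃ κ) (hσ : ∀ t, (C.bar (σ t)).endpoints = (B.bar t).endpoints) : Iso V W where
  app i := LinearEquiv.ofLinearMap (B.transfer C σ i) (C.transfer B σ.symm i)
    (LinearMap.ext fun w => transfer_transfer (σ := σ.symm)
      (fun t => by rw [← hσ, σ.apply_symm_apply]) i w)
    (LinearMap.ext fun v => transfer_transfer hσ i v)
  comm := by
    rintro _ _ ⟨i⟩ v
    exact transfer_next hσ i v

theorem nonempty_iso
    (h : ∀ I, #{t | (B.bar t).endpoints = I} = #{t | (C.bar t).endpoints = I}) :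
    Nonempty (Iso V W) := by
  have e (I) : {t // (B.bar t).endpoints = I} ≃ {t // (C.bar t).endpoints = I} :=
    Fintype.equivOfCardEq (by simpa only [Fintype.card_subtype] using h I)
  exact ⟨iso (Equiv.ofFiberEquiv e) (Equiv.ofFiberEquiv_map e)⟩

end Transfer

end Barcode

open Barcode in
theorem isComplete_singleton (hα : StrictAnti fun i : Fin (ℓ + 1) => α (x i)) :
    IsComplete K {α} := by
  classical
  intro V W hVW
  obtain ⟨ι, _, ⟨B⟩⟩ := exists_barcode V
  obtain ⟨κ, _, ⟨C⟩⟩ := exists_barcode W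
  refine nonempty_iso (B := B) (C := C) fun I => ?_
  by_cases hI : I.1 ≤ I.2
  · refine card_filter_eq_of_card_filter_intervalMean_eq hα (fun μ i => ?_) hI
    have hdim := congrFun (dim_eq_of_hnType_eq (hVW α rfl)
      (isTruncation_span_filter (B := B) hα.antitone μ)
      (isTruncation_span_filter (B := C) hα.antitone μ)) i
    rw [dim_span, dim_span, filter_filter, filter_filter] at hdim
    exact hdim
  · have hempty {U : QuiverRep K (OrdinaryQuiver ℓ)} (J : IntervalSummand U) : J.endpoints ≠ I :=
      fun h => hI (h ▸ J.birth_le_death)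
    simp only [hempty, filter_false, card_empty]

end QuiverRep

theorem corollary4p5 {K : Type*} [Field K] (ℓ : ℕ) (α : OrdinaryQuiver ℓ → ℝ) :
    QuiverRep.IsComplete K {α} ↔
      ∀ i : Fin ℓ, α (OrdinaryQuiver.x i.castSucc) > α (OrdinaryQuiver.x i.succ) :=
  ⟨fun h i => h.lt_of_edge (OrdinaryQuiver.Edge.edge i),
    fun h => QuiverRep.isComplete_singleton (Fin.strictAnti_iff_succ_lt.2 h)⟩
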